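/- Let $\mathbf C$ be an essentially small category with pushouts, let $\mathrm{Ind}(\mathbf C)$ be its category of ind-objects (presheaves of sets that are filtered colimits of representables), and write $X(n)$ for the set of morphisms $n\to X$ with $n\in\mathbf C$, $X\in\mathrm{Ind}(\mathbf C)$. A compact ordered space is a compact topological space with a partial order that is closed in its square; $\mathbf{KOrd}$ is the category of these with continuous order-preserving maps. A $\mathbf C$-adic compact ordered space is a functor $S\colon\mathbf C^{\mathrm{op}}\to\mathbf{KOrd}$ such that (i) for every pushout square $n\xrightarrow{a}k\xrightarrow{c}m$, $n\xrightarrow{b}l\xrightarrow{d}m$ in $\mathbf C$ and all $y\in S(k)$, $z\in S(l)$ with $S(a)(y)\le S(b)(z)$ there is $w\in S(m)$ with $y\le S(c)(w)$ and $S(d)(w)\le z$; (ii) for every $\sigma\colon n\to m$ in $\mathbf C$ the image under $S(\sigma)$ of an up-set is an up-set. It is Gödel–Dummett if it is locally linear (for every $n\in\mathbf C$ and $z\in S(n)$ the set ${\uparrow}z$ is linearly ordered) and co-bounded (whenever $\sigma\colon n\to m$, $y\in S(n)$, $x\in S(m)$ and $y\le S(\sigma)(x)$, there is $x'\le x$ with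 $S(\sigma)(x')=y$). For $X\in\mathrm{Ind}(\mathbf C)$ let $S(X)$ be the set of natural transformations $X\to S$, ordered pointwise; a morphism $f\colon X\to Y$ induces $S(f)\colon S(Y)\to S(X)$ by precomposition, and for $x\in S(X)$, $p\in X(n)$ write $x(p)\in S(n)$ for the image of $p$. A Gödel–Dummett model of $S$ consists of $Y\in\mathrm{Ind}(\mathbf C)$, a linearly ordered set $I$ and an order-preserving family $(y_i)_{i\in I}$ in $S(Y)$ such that for all $i\in I$, $\sigma\colon n\to m$ in $\mathbf C$, $p\in Y(n)$ and $t\in S(m)$: 1. if $S(\sigma)(t)\le y_i(p)$, then there is $q\in Y(m)$ with $q\circ\sigma=p$ and $t\le y_i(q)$; 2. if $y_i(p)\le S(\sigma)(t)$, then there are $j\ge i$ in $I$ and $q\in Y(m)$ with $q\circ\sigma=p$ and $y_j(q)=t$. Let $S$ be a Gödel–Dummett $\mathbf C$-adic compact ordered space. Let $X\in\mathrm{Ind}(\mathbf C)$, let $I$ be a linearly ordered set and let $(x_i)_{i\in I}$ be an order-preserving family in $S(X)$. Then there are a morphism $f\colon X\to Y$ in $\mathrm{Ind}(\mathbf C)$,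 a linearly ordered set $I'$ containing $I$ (with the induced order) and a Gödel–Dummett model $(y_i)_{i\in I'}$ in $S(Y)$ such that $x_i=S(f)(y_i)$ for all $i\in I$; moreover, if $I$ has a minimal element, $I'$ can be chosen so that this element is still minimal in $I'$. Consequently, Gödel–Dummett models are a complete semantics for $S$: for all $n\in\mathbf C$ and $t\in S(n)$ there are a Gödel–Dummett model $(y_i)_{i\in I'}$ in $S(Y)$ with a minimal element $i_0\in I'$ and an $n$-point $p\in Y(n)$ such that $y_{i_0}(p)=t$. -/

import Mathlib

open CategoryTheory CategoryTheory.Limits Opposite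

universe v u

/-- A compact ordered space: a compact topological space with a partial order which is closed as a
subset of the square. -/
structure KOrd : Type (u + 1) where
  carrier : Type u
  [topology : TopologicalSpace carrier]
  [order : PartialOrder carrier]
  [compact : CompactSpace carrier]
  [closed : OrderClosedTopology carrier]

namespace KOrd

instance : CoeSort KOrd.{u} (Type u) := ⟨KOrd.carrier⟩

attribute [instance] KOrd.topology KOrd.order KOrd.compact KOrd.closed

/-- Morphisms of compact ordered spaces: continuous order-preserving maps. -/
@[ext]
structure Hom (A B : KOrd.{u}) where
  hom' : A →Co B

instance : Category KOrd.{u} where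
  Hom A B := Hom A B
  id A := ⟨ContinuousOrderHom.id A⟩
  comp f g := ⟨g.hom'.comp f.hom'⟩

instance : ConcreteCategory KOrd.{u} (fun A B => A →Co B) where
  hom f := f.hom'
  ofHom f := ⟨f⟩

end KOrd

namespace Polyadic

/-- The interpolation property of a lax square `u ∘ f ≤ v ∘ g` of posets, with
`f : A → B`, `g : A → C`, `u : B → D`, `v : C → D`. -/
def HasInterpolation {A B C D : Type*} [Preorder B] [Preorder C] [Preorder D]
    (f : A → B) (g : A → C) (u : B → D) (v : C → D) : Prop :=
  ∀ (b : B) (c : C), u b ≤ v c → ∃ a : A, b ≤ f a ∧ g a ≤ c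

/-- A map of posets is bounded if the direct image of each up-set is an up-set. -/
def IsBoundedMap {A B : Type*} [Preorder A] [Preorder B] (f : A → B) : Prop :=
  ∀ U : Set A, IsUpperSet U → IsUpperSet (f '' U)

/-- A poset is locally linear if every principal up-set is linearly ordered. -/
def IsLocallyLinear (A : Type*) [Preorder A] : Prop :=
  ∀ z a b : A, z ≤ a → z ≤ b → a ≤ b ∨ b ≤ a

variable {C : Type u} [Category.{v} C]

/-- A `C`-adic compact ordered space: a functor `Cᵒᵖ ⥤ KOrd` sending pushout squares to squares
with interpolation and all morphisms to bounded maps. (The transpose of a pushout square is a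
pushout square, so interpolation holds in both directions.) -/
structure IsPolyadic (S : Cᵒᵖ ⥤ KOrd.{v}) : Prop where
  interpolation : ∀ {n k l m : C} (a : n ⟶ k) (b : n ⟶ l) (c : k ⟶ m) (d : l ⟶ m),
    IsPushout a b c d → HasInterpolation (S.map c.op) (S.map d.op) (S.map a.op) (S.map b.op)
  bounded : ∀ {n m : C} (σ : n ⟶ m), IsBoundedMap (S.map σ.op)

/-- Co-boundedness: if `y ≤ S(σ)(x)`, then `y = S(σ)(x')` for some `x' ≤ x`. -/
def IsCobounded (S : Cᵒᵖ ⥤ KOrd.{v}) : Prop :=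
  ∀ {n m : C} (σ : n ⟶ m) (y : S.obj (op n)) (x : S.obj (op m)),
    y ≤ S.map σ.op x → ∃ x' : S.obj (op m), x' ≤ x ∧ S.map σ.op x' = y

/-- Gödel–Dummett functors to compact ordered spaces: locally linear and co-bounded. -/
structure IsGodelDummett (S : Cᵒᵖ ⥤ KOrd.{v}) : Prop where
  locallyLinear : ∀ n : C, IsLocallyLinear (S.obj (op n))
  cobounded : IsCobounded S

/-- The set of `n`-points of an ind-object `X`, i.e. the value at `n` of `X` seen as a presheaf;
by the Yoneda lemma, these are the morphisms `n ⟶ X` of ind-objects. -/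
abbrev Points (X : Ind C) (n : C) : Type v := ((Ind.inclusion C).obj X).obj (op n)

/-- Precomposition of an `m`-point of an ind-object with `σ : n ⟶ m`. -/
noncomputable def Points.precomp {X : Ind C} {n m : C} (σ : n ⟶ m) (q : Points X m) :
    Points X n :=
  ((Ind.inclusion C).obj X).map σ.op q

/-- The points of the space `S(X)` of `X`-types of `S`, for an ind-object `X`: the natural
transformations from `X`, seen as a presheaf of sets, to `S`. -/
def TypeSpace (S : Cᵒᵖ ⥤ KOrd.{v}) (X : Ind C) : Type (max u v) :=
  (Ind.inclusion C).obj X ⟶ S ⋙ forget KOrd.{v}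

namespace TypeSpace

variable {S : Cᵒᵖ ⥤ KOrd.{v}}

/-- The type in `S(n)` of an `n`-point `p` of `X`: the composite `n ⟶ X ⟶ S`. -/
noncomputable def eval {X : Ind C} (x : TypeSpace S X) {n : C} (p : Points X n) : S.obj (op n) :=
  (NatTrans.app (F := (Ind.inclusion C).obj X) (G := S ⋙ forget KOrd.{v}) x (op n)) p

/-- The composite `X ⟶ Y ⟶ S`. -/
noncomputable def precomp {X Y : Ind C} (f : X ⟶ Y) (y : TypeSpace S Y) : TypeSpace S X :=
  show (Ind.inclusion C).obj X ⟶ S ⋙ forget KOrd.{v} from (Ind.inclusion C).map f ≫ y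

/-- `X`-types are ordered pointwise. -/
instance (X : Ind C) : PartialOrder (TypeSpace S X) where
  le x y := ∀ (n : C) (p : Points X n), x.eval p ≤ y.eval p
  le_refl _ _ _ := le_refl _
  le_trans _ _ _ h h' n p := (h n p).trans (h' n p)
  le_antisymm x y h h' := by
    refine NatTrans.ext (funext fun n => ?_)
    refine ConcreteCategory.hom_ext _ _ fun p => ?_
    exact le_antisymm (α := S.obj n) (h n.unop p) (h' n.unop p)

end TypeSpace

/-- A Gödel–Dummett model of `S` with carrier `X`: a linearly ordered constant-domain
(ω-saturated) Kripke model, that is, an increasing linear sequence of `X`-types with the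
saturation conditions corresponding to existential and to universal quantification. -/
structure IsGodelDummettModel {S : Cᵒᵖ ⥤ KOrd.{v}} {X : Ind C} {I : Type v} [LinearOrder I]
    (x : I → TypeSpace S X) : Prop where
  monotone : Monotone x
  existential : ∀ (i : I) {n m : C} (σ : n ⟶ m) (p : Points X n) (t : S.obj (op m)),
    S.map σ.op t ≤ (x i).eval p →
      ∃ q : Points X m, q.precomp σ = p ∧ t ≤ (x i).eval q
  universal : ∀ (i : I) {n m : C} (σ : n ⟶ m) (p : Points X n) (t : S.obj (op m)),
    (x i).eval p ≤ S.map σ.op t →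
      ∃ j : I, i ≤ j ∧ ∃ q : Points X m, q.precomp σ = p ∧ (x j).eval q = t

end Polyadic

/-! A saturated chain is built as the limit of ω steps, each answering all existential and universal
demands of the chain before it.

One demand concerns a point `p` of `X`, a morphism `σ : n ⟶ m` and an index `i`. It asks for an
extension in which `p` factors through `σ` and the `i`-th type of the new point lies above,
respectively below, a given `t`. Interpolation together with boundedness (for `Ici t`) or
co-boundedness (for `Iic t`) solves it over any pushout of `σ`, at the single index `i`; this is
`IsAmalgamable`. `exists_monotoneOn_lift` then extends the other types of a finite chain. Those
above the prescribed one are lifted by boundedness and are comparable by local linearity; those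
below are lifted one after another downwards by co-boundedness. Iterated pushouts handle finitely
many demands (`exists_attachCocone`), and compactness of the spaces of `S` handles all of them, and
the whole chain, at once (`exists_extension`).

A universal demand requires a type that takes the value `t` exactly, whereas the step above only
gives a value below `t`. The type is therefore raised by `TypeSpace.exists_ge_eval_eq`. The raised
types may be added to the chain because, by local linearity, all types above members of the chain
still form a chain. Every added type has an old one below it, so minimal elements stay minimal. -/

namespace Polyadic

variable {C : Type u} [Category.{v} C]

/-! ### Points of ind-objects and types -/

namespace Points

/-- The image of a point under a morphism of ind-objects. -/
noncomputable def map {X Y : Ind C} (f : X ⟶ Y) {n : C} (p : Points X n) : Points Y n :=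
  ((Ind.inclusion C).map f).app (op n) p

theorem precomp_comp {X : Ind C} {n m k : C} (σ : n ⟶ m) (τ : m ⟶ k) (q : Points X k) :
    q.precomp (σ ≫ τ) = (q.precomp τ).precomp σ := by
  simp [precomp]

theorem precomp_id {X : Ind C} {n : C} (q : Points X n) : q.precomp (𝟙 n) = q := by
  simp [precomp]

theorem map_precomp {X Y : Ind C} (f : X ⟶ Y) {n m : C} (σ : n ⟶ m) (q : Points X m) :
    map f (q.precomp σ) = (map f q).precomp σ := by
  simp [precomp, map]

theorem map_comp {X Y Z : Ind C} (f : X ⟶ Y) (g : Y ⟶ Z) {n : C} (p : Points X n) :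
    map (f ≫ g) p = map g (map f p) := by
  simp [map]

end Points

namespace TypeSpace

variable {S : Cᵒᵖ ⥤ KOrd.{v}}

theorem eval_precomp_point {X : Ind C} (x : TypeSpace S X) {n m : C} (σ : n ⟶ m)
    (q : Points X m) : x.eval (q.precomp σ) = S.map σ.op (x.eval q) :=
  NatTrans.naturality_apply (F := (Ind.inclusion C).obj X) (G := S ⋙ forget KOrd.{v}) x σ.op q

theorem eval_precomp {X Y : Ind C} (f : X ⟶ Y) (y : TypeSpace S Y) {n : C} (p : Points X n) :
    (y.precomp f).eval p = y.eval (p.map f) := rfl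

theorem ext_eval {X : Ind C} {x y : TypeSpace S X}
    (h : ∀ (n : C) (p : Points X n), x.eval p = y.eval p) : x = y :=
  le_antisymm (fun n p => (h n p).le) (fun n p => (h n p).ge)

theorem precomp_comp {X Y Z : Ind C} (f : X ⟶ Y) (g : Y ⟶ Z) (z : TypeSpace S Z) :
    z.precomp (f ≫ g) = (z.precomp g).precomp f :=
  ext_eval fun n p => by simp only [eval_precomp, Points.map_comp]

end TypeSpace

theorem map_comp_apply (S : Cᵒᵖ ⥤ KOrd.{v}) {n m k : C} (σ : n ⟶ m) (τ : m ⟶ k)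
    (t : S.obj (op k)) : S.map (σ ≫ τ).op t = S.map σ.op (S.map τ.op t) := by
  simp

theorem map_id_apply (S : Cᵒᵖ ⥤ KOrd.{v}) {n : C} (t : S.obj (op n)) :
    S.map (𝟙 n).op t = t := by
  simp

theorem map_mono (S : Cᵒᵖ ⥤ KOrd.{v}) {n m : C} (σ : n ⟶ m) : Monotone (S.map σ.op) :=
  OrderHomClass.mono (S.map σ.op).hom'

theorem map_continuous (S : Cᵒᵖ ⥤ KOrd.{v}) {n m : C} (σ : n ⟶ m) :
    Continuous (S.map σ.op) :=
  (S.map σ.op).hom'.continuous_toFun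

/-! ### Presentations of ind-objects by directed diagrams -/

/-- A presentation of an ind-object as the colimit of a diagram of objects of `C`, expressed in
terms of points. -/
structure Presentation (X : Ind C) {J : Type v} [Preorder J] (D : J ⥤ C) where
  ι : ∀ j, Points X (D.obj j)
  precomp_ι : ∀ {i j : J} (h : i ⟶ j), (ι j).precomp (D.map h) = ι i
  surj : ∀ {n : C} (p : Points X n), ∃ (j : J) (r : n ⟶ D.obj j), (ι j).precomp r = p
  desc : ∀ (P : Cᵒᵖ ⥤ Type v) (z : ∀ j, P.obj (op (D.obj j))),
    (∀ (i j : J) (h : i ⟶ j), P.map (D.map h).op (z j) = z i) →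
      ∃ φ : (Ind.inclusion C).obj X ⟶ P, ∀ j, φ.app _ (ι j) = z j

theorem Presentation.nonempty_of_isColimit {X : Ind C} {J : Type v} [Preorder J] {D : J ⥤ C}
    (c : Cocone (D ⋙ yoneda)) (hc : IsColimit c) (e : c.pt ≅ (Ind.inclusion C).obj X) :
    Nonempty (Presentation X D) := by
  let c' := c.extend e.hom
  let hc' : IsColimit c' := hc.extendIso e.hom
  let ι : ∀ j, Points X (D.obj j) := fun j => yonedaEquiv (c'.ι.app j)
  refine ⟨⟨ι, ?_, ?_, ?_⟩⟩
  · intro i j h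
    have := c'.w h
    simp only [ι, Points.precomp]
    rw [← this]
    exact yonedaEquiv_naturality _ _
  · intro n p
    obtain ⟨j, r, hr⟩ :=
      Types.jointly_surjective _ (isColimitOfPreserves ((evaluation _ _).obj (op n)) hc') p
    refine ⟨j, r, ?_⟩
    rw [← hr]
    exact map_yonedaEquiv _ _
  · intro P z hz
    let d : Cocone (D ⋙ yoneda) := ⟨P, ⟨fun j => yonedaEquiv.symm (z j), fun i j h => by
      refine (yonedaEquiv_symm_naturality_left _ _ _).trans ?_
      refine (congrArg yonedaEquiv.symm (hz i j h)).trans ?_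
      exact (Category.comp_id _).symm⟩⟩
    refine ⟨hc'.desc d, fun j => ?_⟩
    have := congrArg yonedaEquiv (hc'.fac d j)
    exact this.trans (Equiv.apply_symm_apply _ _)

/-- A final functor from a directed poset replaces the filtered index category, so that later
inverse systems are indexed by directed orders. -/
theorem exists_presentation (X : Ind C) :
    ∃ (J : Type v) (_ : PartialOrder J) (_ : IsDirectedOrder J) (_ : Nonempty J) (D : J ⥤ C),
      Nonempty (Presentation X D) := by
  obtain ⟨J, hJ, hd, hne, F, hF⟩ := IsFiltered.exists_directed X.presentation.I
  refine ⟨J, hJ, hd, hne, F ⋙ X.presentation.F, ?_⟩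
  exact Presentation.nonempty_of_isColimit (X.presentation.cocone.whisker F)
    ((Functor.Final.isColimitWhiskerEquiv F _).symm X.presentation.coconeIsColimit) (Iso.refl _)

theorem exists_ind_of_diagram {J : Type v} [PartialOrder J] [IsDirectedOrder J] [Nonempty J]
    (D : J ⥤ C) : ∃ X : Ind C, Nonempty (Presentation X D) :=
  ⟨(Ind.lim J).obj D, Presentation.nonempty_of_isColimit (colimit.cocone (D ⋙ yoneda))
    (colimit.isColimit _) (Ind.limCompInclusion.app D).symm⟩

/-- An ind-object with the points and the universal property of the colimit of a sequence. -/
theorem exists_sequential_colimit (X : ℕ → Ind C) (f : ∀ k, X k ⟶ X (k + 1)) :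
    ∃ (Y : Ind C) (g : ∀ k, X k ⟶ Y), (∀ k, f k ≫ g (k + 1) = g k) ∧
      (∀ {n : C} (p : Points Y n), ∃ (k : ℕ) (r : Points (X k) n), r.map (g k) = p) ∧
      ∀ (P : Cᵒᵖ ⥤ Type v) (z : ∀ k, (Ind.inclusion C).obj (X k) ⟶ P),
        (∀ k, (Ind.inclusion C).map (f k) ≫ z (k + 1) = z k) →
          ∃ φ : (Ind.inclusion C).obj Y ⟶ P, ∀ k, (Ind.inclusion C).map (g k) ≫ φ = z k := by
  -- `ℕ` is lifted to `Type v`, the size of the filtered colimits that exist in `Ind C` and are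
  -- preserved by the inclusion.
  let U : ULift.{v} ℕ ⥤ ℕ := Monotone.functor (f := ULift.down) fun _ _ h => h
  let F : ULift.{v} ℕ ⥤ Ind C := U ⋙ Functor.ofSequence f
  have hF := isColimitOfPreserves (Ind.inclusion C) (colimit.isColimit F)
  refine ⟨colimit F, fun k => colimit.ι F ⟨k⟩, fun k => ?_, fun {n} p => ?_, fun P z hz => ?_⟩
  · exact (congrArg (fun h => h ≫ colimit.ι F ⟨k + 1⟩)
      (Functor.ofSequence_map_homOfLE_succ f k).symm).trans
        (colimit.w F (show (⟨k⟩ : ULift.{v} ℕ) ⟶ ⟨k + 1⟩ from homOfLE (Nat.le_add_right k 1)))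
  · obtain ⟨k, r, hr⟩ :=
      Types.jointly_surjective _ (isColimitOfPreserves ((evaluation _ _).obj (op n)) hF) p
    exact ⟨k.down, r, hr⟩
  · let α : Functor.ofSequence f ⋙ Ind.inclusion C ⟶ (Functor.const ℕ).obj P :=
      NatTrans.ofSequence z fun k => by
        refine Eq.trans ?_ ((hz k).trans (Category.comp_id _).symm)
        exact congrArg (fun h => (Ind.inclusion C).map h ≫ z (k + 1))
          (Functor.ofSequence_map_homOfLE_succ f k)
    let d : Cocone (F ⋙ Ind.inclusion C) := ⟨P, Functor.whiskerLeft U α⟩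
    exact ⟨hF.desc d, fun k => hF.fac d ⟨k⟩⟩

namespace Presentation

variable {S : Cᵒᵖ ⥤ KOrd.{v}} {X : Ind C} {J : Type v} [Preorder J] {D : J ⥤ C}
  (P : Presentation X D)

theorem exists_type (z : ∀ j, S.obj (op (D.obj j)))
    (hz : ∀ (i j : J) (h : i ⟶ j), S.map (D.map h).op (z j) = z i) :
    ∃ x : TypeSpace S X, ∀ j, x.eval (P.ι j) = z j :=
  P.desc (S ⋙ forget KOrd.{v}) z hz

theorem exists_hom (Y : Ind C) (z : ∀ j, Points Y (D.obj j))
    (hz : ∀ (i j : J) (h : i ⟶ j), (z j).precomp (D.map h) = z i) :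
    ∃ f : X ⟶ Y, ∀ j, (P.ι j).map f = z j := by
  obtain ⟨φ, hφ⟩ := P.desc _ z hz
  obtain ⟨f, rfl⟩ := (Ind.inclusion C).map_surjective φ
  exact ⟨f, hφ⟩

theorem le_of_eval_ι_le {x y : TypeSpace S X} (h : ∀ j, x.eval (P.ι j) ≤ y.eval (P.ι j)) :
    x ≤ y := fun n p => by
  obtain ⟨j, r, rfl⟩ := P.surj p
  rw [TypeSpace.eval_precomp_point, TypeSpace.eval_precomp_point]
  exact map_mono S r (h j)

theorem ext_ι {x y : TypeSpace S X} (h : ∀ j, x.eval (P.ι j) = y.eval (P.ι j)) : x = y :=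
  le_antisymm (P.le_of_eval_ι_le fun j => (h j).le) (P.le_of_eval_ι_le fun j => (h j).ge)

theorem map_eval_ι (x : TypeSpace S X) {i j : J} (h : i ⟶ j) :
    S.map (D.map h).op (x.eval (P.ι j)) = x.eval (P.ι i) := by
  rw [← TypeSpace.eval_precomp_point, P.precomp_ι]

end Presentation

/-- A type is determined by its values on a `v`-small presentation. This allows sets of types to
serve as index sets in `Type v`. -/
instance small_typeSpace (S : Cᵒᵖ ⥤ KOrd.{v}) (X : Ind C) : Small.{v} (TypeSpace S X) := by
  obtain ⟨J, _, _, _, D, ⟨P⟩⟩ := exists_presentation X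
  exact small_of_injective (β := ∀ j, S.obj (op (D.obj j)))
    (f := fun (x : TypeSpace S X) j => x.eval (P.ι j))
    fun x y h => P.ext_ι fun j => congrFun h j

/-! ### Compactness -/

/-- A directed inverse system of nonempty closed subsets of compact Hausdorff spaces has a
compatible family. -/
theorem exists_compatible_of_compact {J : Type*} [Preorder J] [IsDirectedOrder J] [Nonempty J]
    {Z : J → Type*} [∀ j, TopologicalSpace (Z j)] [∀ j, CompactSpace (Z j)] [∀ j, T2Space (Z j)]
    (φ : ∀ i j, i ≤ j → Z j → Z i) (hφ : ∀ i j h, Continuous (φ i j h))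
    (hcomp : ∀ i j k (h : i ≤ j) (h' : j ≤ k) (z : Z k),
      φ i j h (φ j k h' z) = φ i k (h.trans h') z)
    (K : ∀ j, Set (Z j)) (hclosed : ∀ j, IsClosed (K j)) (hne : ∀ j, (K j).Nonempty)
    (hK : ∀ i j (h : i ≤ j), ∀ z ∈ K j, φ i j h z ∈ K i) :
    ∃ z : ∀ j, Z j, (∀ j, z j ∈ K j) ∧ ∀ i j (h : i ≤ j), φ i j h (z j) = z i := by
  classical
  let t : J → Set (∀ j, Z j) := fun j => {z | z j ∈ K j ∧ ∀ i (h : i ≤ j), φ i j h (z j) = z i}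
  have hanti : ∀ i j, i ≤ j → t j ⊆ t i := by
    rintro i j h z ⟨h1, h2⟩
    refine ⟨h2 i h ▸ hK i j h _ h1, fun l hl => ?_⟩
    rw [← h2 i h, hcomp, h2]
  have hclosed_t : ∀ j, IsClosed (t j) := by
    intro j
    have : t j = Function.eval j ⁻¹' K j ∩ ⋂ i, ⋂ h : i ≤ j, {z | φ i j h (z j) = z i} := by
      ext z
      simp [t]
    rw [this]
    exact ((hclosed j).preimage (continuous_apply j)).inter <| isClosed_iInter fun i => isClosed_iInter fun h =>
      isClosed_eq ((hφ i j h).comp (continuous_apply j)) (continuous_apply i)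
  have hne_t : ∀ j, (t j).Nonempty := by
    intro j
    obtain ⟨a, ha⟩ := hne j
    -- Membership in `t j` constrains only the coordinates below `j`; the others are arbitrary.
    let z : ∀ i, Z i := fun i => if h : i ≤ j then φ i j h a else (hne i).some
    have hz : ∀ i (h : i ≤ j), z i = φ i j h a := fun i h => dif_pos h
    refine ⟨z, ?_, fun i h => ?_⟩
    · rw [hz j le_rfl]
      exact hK _ _ _ _ ha
    · rw [hz j le_rfl, hz i h, hcomp]
  obtain ⟨z, hz⟩ := IsCompact.nonempty_iInter_of_directed_nonempty_isCompact_isClosed t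
    (fun i j => by
      obtain ⟨k, hi, hj⟩ := exists_ge_ge i j
      exact ⟨k, hanti _ _ hi, hanti _ _ hj⟩)
    hne_t (fun j => (hclosed_t j).isCompact) hclosed_t
  rw [Set.mem_iInter] at hz
  exact ⟨z, fun j => (hz j).1, fun i j h => (hz j).2 i h⟩

variable {S : Cᵒᵖ ⥤ KOrd.{v}}

theorem IsBoundedMap.exists_ge {A B : Type*} [Preorder A] [Preorder B] {f : A → B}
    (hf : IsBoundedMap f) {a : A} {b : B} (h : f a ≤ b) : ∃ a', a ≤ a' ∧ f a' = b :=
  hf (Set.Ici a) (isUpperSet_Ici a) h ⟨a, le_rfl, rfl⟩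

/-- Two failures of comparison can be pushed to a common later stage of a presentation, where local
linearity of `S` refutes one of them. -/
theorem TypeSpace.isLocallyLinear (hGD : IsGodelDummett S) (X : Ind C) :
    IsLocallyLinear (TypeSpace S X) := by
  intro z a b hza hzb
  obtain ⟨J, _, _, _, D, ⟨P⟩⟩ := exists_presentation X
  by_contra! h
  obtain ⟨i, hi⟩ : ∃ i, ¬ a.eval (P.ι i) ≤ b.eval (P.ι i) := by
    by_contra! h'
    exact h.1 (P.le_of_eval_ι_le h')
  obtain ⟨j, hj⟩ : ∃ j, ¬ b.eval (P.ι j) ≤ a.eval (P.ι j) := by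
    by_contra! h'
    exact h.2 (P.le_of_eval_ι_le h')
  obtain ⟨k, hik, hjk⟩ := exists_ge_ge i j
  rcases hGD.locallyLinear _ _ _ _ (hza _ (P.ι k)) (hzb _ (P.ι k)) with hk | hk
  · apply hi
    rw [← P.map_eval_ι a (homOfLE hik), ← P.map_eval_ι b (homOfLE hik)]
    exact map_mono S _ hk
  · apply hj
    rw [← P.map_eval_ι a (homOfLE hjk), ← P.map_eval_ι b (homOfLE hjk)]
    exact map_mono S _ hk

/-- Boundedness raises the type at each stage of a presentation, and compactness makes the choices
compatible. -/
theorem TypeSpace.exists_ge_eval_eq (hS : IsPolyadic S) {X : Ind C} (y : TypeSpace S X) {m : C}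
    (q : Points X m) {t : S.obj (op m)} (h : y.eval q ≤ t) :
    ∃ z : TypeSpace S X, y ≤ z ∧ z.eval q = t := by
  obtain ⟨J, _, _, _, D, ⟨P⟩⟩ := exists_presentation X
  obtain ⟨j₀, r, rfl⟩ := P.surj q
  obtain ⟨z, hz, hzc⟩ := exists_compatible_of_compact (J := J)
    (Z := fun j => S.obj (op (D.obj j))) (fun i j h => S.map (D.map (homOfLE h)).op)
    (fun i j h => map_continuous S _)
    (fun i j k h h' z => by
      rw [← map_comp_apply, ← D.map_comp, homOfLE_comp])
    -- The second condition is vacuous at stages not above `j₀`, where `q` need not be visible.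
    (fun j => {z | y.eval (P.ι j) ≤ z ∧
      ∀ h : j₀ ≤ j, S.map (r ≫ D.map (homOfLE h)).op z = t})
    (fun j => by
      rw [Set.ofPred_and, Set.ofPred_forall]
      exact (isClosed_Ici (a := y.eval (P.ι j))).inter <| isClosed_iInter fun h => isClosed_eq (map_continuous S _) continuous_const)
    (fun j => by
      by_cases hj : j₀ ≤ j
      · obtain ⟨z, hz, hzt⟩ := (hS.bounded (r ≫ D.map (homOfLE hj))).exists_ge
          (a := y.eval (P.ι j)) (b := t) (by
            rwa [map_comp_apply, P.map_eval_ι, ← TypeSpace.eval_precomp_point])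
        exact ⟨z, hz, fun _ => hzt⟩
      · exact ⟨y.eval (P.ι j), le_rfl, fun h => (hj h).elim⟩)
    (fun i j h z hz => by
      refine ⟨?_, fun hi => ?_⟩
      · rw [← P.map_eval_ι y (homOfLE h)]
        exact map_mono S _ hz.1
      · rw [← map_comp_apply, Category.assoc, ← D.map_comp, homOfLE_comp]
        exact hz.2 (hi.trans h))
  obtain ⟨x, hx⟩ := P.exists_type z fun i j h => hzc i j (leOfHom h)
  refine ⟨x, P.le_of_eval_ι_le fun j => hx j ▸ (hz j).1, ?_⟩
  rw [TypeSpace.eval_precomp_point, hx, ← (hz j₀).2 le_rfl]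
  simp

/-! ### Amalgamation and extension of finite chains over the base category -/

/-- A closed condition `K` on types of `m` is amalgamable over `σ : n ⟶ m` and a type `v` of `n` if,
for every pushout `k'` of `σ` and `n ⟶ k`, each type of `k` extending `v` extends to a type of `k'`
satisfying `K`. -/
structure IsAmalgamable {n m : C} (σ : n ⟶ m) (v : S.obj (op n)) (K : Set (S.obj (op m))) :
    Prop where
  isClosed : IsClosed K
  exists_amalgam : ∀ {k k' : C} {a : n ⟶ k} {d : m ⟶ k'} {c : k ⟶ k'}, IsPushout σ a d c →
    ∀ y : S.obj (op k), S.map a.op y = v →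
      ∃ w : S.obj (op k'), S.map c.op w = y ∧ S.map d.op w ∈ K

/-- Interpolation gives a type whose restriction to `k` is only below `y`; boundedness raises it to
restrict to `y`, which preserves the lower bound `t`. -/
theorem isAmalgamable_Ici (hS : IsPolyadic S) {n m : C} {σ : n ⟶ m} {v : S.obj (op n)}
    {t : S.obj (op m)} (hv : S.map σ.op t ≤ v) : IsAmalgamable σ v (Set.Ici t) := by
  refine ⟨isClosed_Ici, ?_⟩
  rintro k k' a d c h y rfl
  obtain ⟨w, hw, hw'⟩ := hS.interpolation _ _ _ _ h _ _ hv
  obtain ⟨w', hle, rfl⟩ := (hS.bounded c).exists_ge hw'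
  exact ⟨w', rfl, hw.trans (map_mono S d hle)⟩

/-- Dual to `isAmalgamable_Ici`: the transposed square is interpolated, and co-boundedness lowers
the result. -/
theorem isAmalgamable_Iic (hS : IsPolyadic S) (hGD : IsGodelDummett S) {n m : C} {σ : n ⟶ m}
    {v : S.obj (op n)} {t : S.obj (op m)} (hv : v ≤ S.map σ.op t) :
    IsAmalgamable σ v (Set.Iic t) := by
  refine ⟨isClosed_Iic, ?_⟩
  rintro k k' a d c h y rfl
  obtain ⟨w, hw, hw'⟩ := hS.interpolation _ _ _ _ h.flip _ _ hv
  obtain ⟨w', hle, rfl⟩ := hGD.cobounded c _ _ hw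
  exact ⟨w', rfl, (map_mono S d hle).trans hw'⟩

/-- Used to replace the objects of `C` by those of a small model, so that all demands form a small
set. -/
theorem IsAmalgamable.of_iso {n m n' m' : C} {σ : n ⟶ m} {v : S.obj (op n)}
    {K : Set (S.obj (op m))} (h : IsAmalgamable σ v K) (φ : n' ≅ n) (ψ : m' ≅ m) :
    IsAmalgamable (φ.hom ≫ σ ≫ ψ.inv) (S.map φ.hom.op v) (S.map ψ.inv.op ⁻¹' K) := by
  refine ⟨h.isClosed.preimage (map_continuous S _), fun {k k' a d c} hpo y hy => ?_⟩
  have hpo' : IsPushout σ (φ.inv ≫ a) (ψ.inv ≫ d) c :=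
    hpo.of_iso φ ψ (Iso.refl _) (Iso.refl _) (by simp) (by simp) (by simp) (by simp)
  obtain ⟨w, hw, hw'⟩ := h.exists_amalgam hpo' y (by
    rw [map_comp_apply, hy, ← map_comp_apply, φ.inv_hom_id, map_id_apply])
  exact ⟨w, hw, by rwa [map_comp_apply] at hw'⟩

/-- A chain of types extending to a larger object at one index extends at finitely many indices. -/
theorem exists_monotoneOn_lift (hS : IsPolyadic S) (hGD : IsGodelDummett S) {n m : C}
    (c : n ⟶ m) {I : Type*} [LinearOrder I] {A : Finset I} {x : I → S.obj (op n)}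
    (hx : MonotoneOn x A) {i₀ : I} (hi₀ : i₀ ∈ A) {w : S.obj (op m)}
    (hw : S.map c.op w = x i₀) :
    ∃ y : I → S.obj (op m), MonotoneOn y A ∧ (∀ i ∈ A, S.map c.op (y i) = x i) ∧ y i₀ = w := by
  classical
  suffices H : ∀ s : Finset I, ∃ y : I → S.obj (op m),
      MonotoneOn y {i | i ∈ A ∧ (i ∈ s ∨ i₀ ≤ i)} ∧
      (∀ i ∈ A, (i ∈ s ∨ i₀ ≤ i) → S.map c.op (y i) = x i) ∧ y i₀ = w by
    obtain ⟨y, h1, h2, h3⟩ := H A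
    exact ⟨y, fun i hi j hj => h1 ⟨hi, .inl hi⟩ ⟨hj, .inl hj⟩, fun i hi => h2 i hi (.inl hi), h3⟩
  intro s
  induction s using Finset.induction_on_min with
  | empty =>
    -- Lifts above `i₀` are chosen as a function of the value `x i`, not of `i`. All lie above `w`,
    -- hence are comparable; if two come in the wrong order, their restrictions agree, and then so
    -- do the lifts.
    have hg : ∀ v : S.obj (op n), ∃ u : S.obj (op m),
        (x i₀ ≤ v → w ≤ u ∧ S.map c.op u = v) ∧ (v = x i₀ → u = w) := by
      intro v
      by_cases hv : v = x i₀
      · exact ⟨w, fun _ => ⟨le_rfl, hw.trans hv.symm⟩, fun _ => rfl⟩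
      · by_cases hv' : x i₀ ≤ v
        · obtain ⟨u, hu⟩ := (hS.bounded c).exists_ge (hw.trans_le hv')
          exact ⟨u, fun _ => hu, fun h => (hv h).elim⟩
        · exact ⟨w, fun h => (hv' h).elim, fun h => (hv h).elim⟩
    choose g hg hg' using hg
    refine ⟨fun i => g (x i), ?_, ?_, hg' _ rfl⟩
    · rintro i ⟨hi, hi'⟩ j ⟨hj, hj'⟩ hij
      simp only [Finset.notMem_empty, false_or] at hi' hj'
      obtain ⟨h1, h2⟩ := hg _ (hx hi₀ hi hi')
      obtain ⟨h3, h4⟩ := hg _ (hx hi₀ hj hj')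
      rcases hGD.locallyLinear _ _ _ _ h1 h3 with h | h
      · exact h
      · have := map_mono S c h
        rw [h2, h4] at this
        exact (congrArg g (le_antisymm this (hx hi hj hij))).ge
    · intro i hi hi'
      simp only [Finset.notMem_empty, false_or] at hi'
      exact (hg _ (hx hi₀ hi hi')).2
  | insert a s has ih =>
    obtain ⟨y, h1, h2, h3⟩ := ih
    by_cases ha : a ∈ A ∧ a < i₀
    · obtain ⟨haA, hai⟩ := ha
      have hne : (A.filter fun i => i ∈ s ∨ i₀ ≤ i).Nonempty :=
        ⟨i₀, Finset.mem_filter.2 ⟨hi₀, .inr le_rfl⟩⟩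
      -- `b` is the least index already lifted; the lift at `a` is placed below `y b`.
      set b := (A.filter fun i => i ∈ s ∨ i₀ ≤ i).min' hne with hb
      obtain ⟨hbA, hbs⟩ := Finset.mem_filter.1 (Finset.min'_mem _ hne)
      rw [← hb] at hbA hbs
      have hab : ∀ i, (i ∈ s ∨ i₀ ≤ i) → a < i := fun i hi =>
        hi.elim (has i) hai.trans_le
      obtain ⟨u, hu, hu'⟩ := hGD.cobounded c (x a) (y b) (by
        rw [h2 b hbA hbs]
        exact hx haA hbA (hab b hbs).le)
      have hne' : ∀ i, (i ∈ s ∨ i₀ ≤ i) → Function.update y a u i = y i := fun i hi =>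
        Function.update_of_ne (hab i hi).ne' _ _
      have hcases : ∀ i, (i ∈ insert a s ∨ i₀ ≤ i) → i = a ∨ (i ∈ s ∨ i₀ ≤ i) := by
        intro i hi
        rwa [Finset.mem_insert, or_assoc] at hi
      refine ⟨Function.update y a u, ?_, ?_, ?_⟩
      · rintro i ⟨hi, hi'⟩ j ⟨hj, hj'⟩ hij
        rcases hcases i hi' with rfl | hi'' <;> rcases hcases j hj' with rfl | hj''
        · exact le_rfl
        · rw [hne' j hj'', Function.update_self]
          exact hu.trans (h1 ⟨hbA, hbs⟩ ⟨hj, hj''⟩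
            (Finset.min'_le _ _ (Finset.mem_filter.2 ⟨hj, hj''⟩)))
        · exact absurd (hab i hi'') hij.not_gt
        · rw [hne' i hi'', hne' j hj'']
          exact h1 ⟨hi, hi''⟩ ⟨hj, hj''⟩ hij
      · intro i hi hi'
        rcases hcases i hi' with rfl | hi'
        · rw [Function.update_self, hu']
        · rw [hne' i hi', h2 i hi hi']
      · rw [hne' i₀ (.inr le_rfl), h3]
    · have hcases : ∀ i ∈ A, (i ∈ insert a s ∨ i₀ ≤ i) → (i ∈ s ∨ i₀ ≤ i) := by
        intro i hi hi'
        rw [Finset.mem_insert, or_assoc] at hi'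
        rcases hi' with rfl | hi'
        · exact .inr (not_lt.1 fun h => ha ⟨hi, h⟩)
        · exact hi'
      exact ⟨y, fun i hi j hj => h1 ⟨hi.1, hcases i hi.1 hi.2⟩ ⟨hj.1, hcases j hj.1 hj.2⟩,
        fun i hi hi' => h2 i hi (hcases i hi hi'), h3⟩

/-! ### Attaching finitely many morphisms to an object -/

section Attach

variable {T : Type v} {n m : T → C} (σ : ∀ τ, n τ ⟶ m τ)

/-- A cocone on an object `k` and the morphisms `σ τ : n τ ⟶ m τ`, for `τ ∈ F`, glued to `k`
along `r τ : n τ ⟶ k`. -/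
structure AttachCocone {k : C} {F : Finset T} (r : ∀ τ ∈ F, n τ ⟶ k) where
  pt : C
  ι : k ⟶ pt
  κ : ∀ τ ∈ F, m τ ⟶ pt
  w : ∀ τ hτ, r τ hτ ≫ ι = σ τ ≫ κ τ hτ

variable {σ}

/-- A colimit cocone: the wide pushout of `k` and the objects `m τ`. -/
def AttachCocone.IsInitial {k : C} {F : Finset T} {r : ∀ τ ∈ F, n τ ⟶ k}
    (c : AttachCocone σ r) : Prop :=
  ∀ c' : AttachCocone σ r, ∃! f : c.pt ⟶ c'.pt,
    c.ι ≫ f = c'.ι ∧ ∀ τ hτ, c.κ τ hτ ≫ f = c'.κ τ hτ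

/-- Hides the transport along `τ = τ₀` behind two equations. -/
theorem exists_forall_mem_insert {T : Type*} [DecidableEq T] {M : T → Type*} {τ₀ : T}
    {F : Finset T} (h₀ : τ₀ ∉ F) (a : M τ₀) (f : ∀ τ ∈ F, M τ) :
    ∃ g : ∀ τ ∈ insert τ₀ F, M τ, (∀ h, g τ₀ h = a) ∧
      ∀ τ h h', g τ h' = f τ h := by
  refine ⟨fun τ h => if h' : τ ∈ F then f τ h' else
    ((Finset.mem_insert.1 h).resolve_right h').symm ▸ a, fun h => ?_, fun τ h h' => ?_⟩
  · exact dif_neg h₀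
  · exact dif_pos h

/-- Finitely many morphisms can be attached to an object, in such a way that every finite chain of
types extends to the colimit with prescribed conditions at the attached objects. -/
theorem exists_attachCocone [HasPushouts C] (hS : IsPolyadic S) (hGD : IsGodelDummett S)
    {I : Type*} [LinearOrder I] {v : ∀ τ, S.obj (op (n τ))} {K : ∀ τ, Set (S.obj (op (m τ)))}
    (hK : ∀ τ, IsAmalgamable (σ τ) (v τ) (K τ))
    (idx : T → I) {k : C} {x : I → S.obj (op k)} (hx : Monotone x) (F : Finset T)
    (r : ∀ τ ∈ F, n τ ⟶ k) (hr : ∀ τ hτ, S.map (r τ hτ).op (x (idx τ)) = v τ) :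
    ∃ c : AttachCocone σ r, c.IsInitial ∧ ∀ A : Finset I, (∀ τ ∈ F, idx τ ∈ A) →
      ∃ y : I → S.obj (op c.pt), MonotoneOn y A ∧ (∀ i ∈ A, S.map c.ι.op (y i) = x i) ∧
        ∀ τ hτ, S.map (c.κ τ hτ).op (y (idx τ)) ∈ K τ := by
  classical
  induction F using Finset.induction_on with
  | empty =>
    refine ⟨⟨k, 𝟙 k, fun τ h => (Finset.notMem_empty τ h).elim,
      fun τ h => (Finset.notMem_empty τ h).elim⟩, fun c' => ?_, fun A _ => ?_⟩
    · exact ⟨c'.ι, ⟨Category.id_comp _, fun τ h => (Finset.notMem_empty τ h).elim⟩,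
        fun f hf => (Category.id_comp f).symm.trans hf.1⟩
    · exact ⟨x, hx.monotoneOn _, fun i _ => map_id_apply S _,
        fun τ h => (Finset.notMem_empty τ h).elim⟩
  | insert τ₀ F h₀ ih =>
    obtain ⟨c, hc, hy⟩ := ih (fun τ h => r τ (Finset.mem_insert_of_mem h))
      (fun τ h => hr τ _)
    obtain ⟨Q, d, e, hpo⟩ : ∃ (Q : C) (d : m τ₀ ⟶ Q) (e : c.pt ⟶ Q),
        IsPushout (σ τ₀) (r τ₀ (Finset.mem_insert_self _ _) ≫ c.ι) d e :=
      ⟨_, _, _, IsPushout.of_hasPushout _ _⟩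
    obtain ⟨κ, hκ₀, hκ⟩ := exists_forall_mem_insert (M := fun τ => m τ ⟶ Q) h₀ d
      (fun τ h => c.κ τ h ≫ e)
    have hcases : ∀ {p : ∀ τ ∈ insert τ₀ F, Prop}, p τ₀ (Finset.mem_insert_self _ _) →
        (∀ τ (h : τ ∈ F), p τ (Finset.mem_insert_of_mem h)) → ∀ τ h, p τ h := by
      intro p h1 h2 τ h
      rcases Finset.mem_insert.1 h with rfl | h'
      · exact h1
      · exact h2 τ h'
    refine ⟨⟨Q, c.ι ≫ e, κ, hcases ?_ fun τ h => ?_⟩, fun c' => ?_, fun A hA => ?_⟩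
    · rw [hκ₀, ← Category.assoc, ← hpo.w]
    · rw [hκ τ h, ← Category.assoc, c.w τ h, Category.assoc]
    · obtain ⟨f, ⟨hf1, hf2⟩, hf3⟩ := hc ⟨c'.pt, c'.ι,
        fun τ h => c'.κ τ (Finset.mem_insert_of_mem h), fun τ h => c'.w τ _⟩
      have hw : σ τ₀ ≫ c'.κ τ₀ (Finset.mem_insert_self _ _) =
          (r τ₀ (Finset.mem_insert_self _ _) ≫ c.ι) ≫ f := by
        rw [Category.assoc, hf1, c'.w]
      refine ⟨hpo.desc _ _ hw, ⟨?_, hcases ?_ fun τ h => ?_⟩, fun g hg => ?_⟩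
      · rw [Category.assoc, hpo.inr_desc, hf1]
      · change κ _ _ ≫ _ = _
        rw [hκ₀, hpo.inl_desc]
      · change κ _ _ ≫ _ = _
        rw [hκ τ h, Category.assoc, hpo.inr_desc, hf2]
      · refine hpo.hom_ext ?_ ?_
        · rw [hpo.inl_desc, ← hg.2 τ₀ (Finset.mem_insert_self _ _)]
          exact congrArg (· ≫ g) (hκ₀ _).symm
        · rw [hpo.inr_desc]
          refine hf3 _ ⟨?_, fun τ h => ?_⟩
          · rw [← Category.assoc]
            exact hg.1
          · rw [← Category.assoc, ← hκ τ h (Finset.mem_insert_of_mem h)]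
            exact hg.2 _ _
    · obtain ⟨y, hy1, hy2, hy3⟩ := hy A fun τ h => hA τ (Finset.mem_insert_of_mem h)
      have hi₀ := hA τ₀ (Finset.mem_insert_self _ _)
      -- Amalgamability is required over every pushout of `σ τ₀`, so it applies although other
      -- objects have already been attached.
      obtain ⟨w, hw1, hw2⟩ := (hK τ₀).exists_amalgam hpo (y (idx τ₀)) (by
        rw [map_comp_apply, hy2 _ hi₀, hr])
      obtain ⟨y', hm, hl, hw⟩ := exists_monotoneOn_lift hS hGD e hy1 hi₀ hw1
      refine ⟨y', hm, fun i hi => ?_, hcases ?_ fun τ h => ?_⟩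
      · rw [map_comp_apply, hl i hi, hy2 i hi]
      · change S.map (κ _ _).op _ ∈ _
        rw [hκ₀, hw]
        exact hw2
      · change S.map (κ _ _).op _ ∈ _
        rw [hκ τ h, map_comp_apply, hl _ (hA τ (Finset.mem_insert_of_mem h))]
        exact hy3 τ h

variable {J : Type v} [PartialOrder J] (D : J ⥤ C) (lvl : T → J)

/-- Stages of a diagram together with finite sets of morphisms to be attached at that stage. -/
@[ext]
structure AttachIndex (lvl : T → J) : Type v where
  stage : J
  tasks : Finset T
  le_stage : ∀ τ ∈ tasks, lvl τ ≤ stage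

instance : PartialOrder (AttachIndex lvl) :=
  PartialOrder.lift (fun a => (a.stage, a.tasks)) fun _ _ h =>
    AttachIndex.ext (congrArg Prod.fst h) (congrArg Prod.snd h)

theorem AttachIndex.stage_le {a b : AttachIndex lvl} (h : a ≤ b) : a.stage ≤ b.stage := h.1

theorem AttachIndex.tasks_subset {a b : AttachIndex lvl} (h : a ≤ b) : a.tasks ⊆ b.tasks := h.2

instance [IsDirectedOrder J] : IsDirectedOrder (AttachIndex lvl) := by
  classical
  refine ⟨fun a b => ?_⟩
  obtain ⟨j, h1, h2⟩ := exists_ge_ge a.stage b.stage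
  refine ⟨⟨j, a.tasks ∪ b.tasks, fun τ h => ?_⟩, ⟨h1, Finset.subset_union_left⟩,
    ⟨h2, Finset.subset_union_right⟩⟩
  rcases Finset.mem_union.1 h with h | h
  · exact (a.le_stage τ h).trans h1
  · exact (b.le_stage τ h).trans h2

/-- The stage of the diagram with nothing attached. -/
def AttachIndex.base (j : J) : AttachIndex lvl :=
  ⟨j, ∅, fun τ h => (Finset.notMem_empty τ h).elim⟩

/-- A stage at which only one morphism is attached. -/
def AttachIndex.single (τ : T) : AttachIndex lvl :=
  ⟨lvl τ, {τ}, fun _ h => (congrArg lvl (Finset.mem_singleton.1 h)).le⟩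

instance [Nonempty J] : Nonempty (AttachIndex lvl) :=
  ⟨AttachIndex.base lvl (Classical.arbitrary J)⟩

variable {lvl} {D} {r : ∀ τ, n τ ⟶ D.obj (lvl τ)}

/-- The attaching maps at a later stage. -/
def attachMap (r : ∀ τ, n τ ⟶ D.obj (lvl τ)) (a : AttachIndex lvl) :
    ∀ τ ∈ a.tasks, n τ ⟶ D.obj a.stage :=
  fun τ h => r τ ≫ D.map (homOfLE (a.le_stage τ h))

/-- Restriction of cocones to an earlier stage. -/
def AttachCocone.restrict {a b : AttachIndex lvl} (h : a ≤ b)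
    (c : AttachCocone σ (attachMap r b)) : AttachCocone σ (attachMap r a) where
  pt := c.pt
  ι := D.map (homOfLE (AttachIndex.stage_le lvl h)) ≫ c.ι
  κ τ hτ := c.κ τ (AttachIndex.tasks_subset lvl h hτ)
  w τ hτ := by
    rw [← c.w]
    simp only [attachMap, Category.assoc]
    rw [← Functor.map_comp_assoc, homOfLE_comp]

section Diagram

variable (c : ∀ a : AttachIndex lvl, AttachCocone σ (attachMap r a))
  (hc : ∀ a, (c a).IsInitial)

/-- The comparison of colimit cocones at two stages. -/
noncomputable def attachHom (a b : AttachIndex lvl) (h : a ≤ b) : (c a).pt ⟶ (c b).pt :=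
  (hc a ((c b).restrict h)).choose

theorem ι_attachHom {a b : AttachIndex lvl} (h : a ≤ b) : (c a).ι ≫ attachHom c hc a b h =
    D.map (homOfLE (AttachIndex.stage_le lvl h)) ≫ (c b).ι :=
  (hc a ((c b).restrict h)).choose_spec.1.1

theorem κ_attachHom {a b : AttachIndex lvl} (h : a ≤ b) (τ : T) (hτ : τ ∈ a.tasks) :
    (c a).κ τ hτ ≫ attachHom c hc a b h = (c b).κ τ (AttachIndex.tasks_subset lvl h hτ) :=
  (hc a ((c b).restrict h)).choose_spec.1.2 τ hτ

theorem attachHom_unique {a b : AttachIndex lvl} (h : a ≤ b) (f : (c a).pt ⟶ (c b).pt)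
    (h1 : (c a).ι ≫ f = D.map (homOfLE (AttachIndex.stage_le lvl h)) ≫ (c b).ι)
    (h2 : ∀ τ hτ, (c a).κ τ hτ ≫ f = (c b).κ τ (AttachIndex.tasks_subset lvl h hτ)) :
    f = attachHom c hc a b h :=
  (hc a ((c b).restrict h)).choose_spec.2 f ⟨h1, h2⟩

/-- Colimit cocones at all stages form a diagram. -/
noncomputable def attachDiagram : AttachIndex lvl ⥤ C where
  obj a := (c a).pt
  map {a b} h := attachHom c hc a b (leOfHom h)
  map_id a := (attachHom_unique c hc _ _ (by simp) (by simp)).symm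
  map_comp {a b d} h h' := (attachHom_unique c hc _ _
    (by rw [← Category.assoc, ι_attachHom, Category.assoc, ι_attachHom, ← Functor.map_comp_assoc,
      homOfLE_comp])
    (fun τ hτ => by rw [← Category.assoc, κ_attachHom, κ_attachHom])).symm

end Diagram

end Attach

/-! ### Simultaneous extension of a chain of types -/

/-- Given a chain of types on `X` and a small set of morphisms `σ τ : n τ ⟶ m τ`, points `p τ` and
amalgamable conditions `K τ`, the chain extends to a larger
ind-object in which all of the conditions are satisfied. -/
theorem exists_extension [HasPushouts C] (hS : IsPolyadic S) (hGD : IsGodelDummett S)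
    {X : Ind C} {I : Type*} [LinearOrder I] {x : I → TypeSpace S X} (hx : Monotone x)
    {T : Type v} {n m : T → C} (σ : ∀ τ, n τ ⟶ m τ) (p : ∀ τ, Points X (n τ)) (idx : T → I)
    {K : ∀ τ, Set (S.obj (op (m τ)))}
    (hK : ∀ τ, IsAmalgamable (σ τ) ((x (idx τ)).eval (p τ)) (K τ)) :
    ∃ (Y : Ind C) (f : X ⟶ Y) (y : I → TypeSpace S Y), Monotone y ∧
      (∀ i, (y i).precomp f = x i) ∧
      ∀ τ, ∃ q : Points Y (m τ), q.precomp (σ τ) = (p τ).map f ∧ (y (idx τ)).eval q ∈ K τ := by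
  classical
  obtain ⟨J, _, _, _, D, ⟨P⟩⟩ := exists_presentation X
  choose lvl r hr using fun τ => P.surj (p τ)
  have := fun a : AttachIndex lvl => exists_attachCocone hS hGD hK idx
    (x := fun i => (x i).eval (P.ι a.stage)) (fun i j h => hx h _ _) a.tasks (attachMap r a)
    (fun τ hτ => by
      rw [attachMap, map_comp_apply, P.map_eval_ι, ← hr, TypeSpace.eval_precomp_point])
  choose c hc hy using this
  obtain ⟨Y, ⟨Q⟩⟩ := exists_ind_of_diagram (attachDiagram c hc)
  have hQ : ∀ a b (h : a ≤ b), (Q.ι b).precomp (attachHom c hc a b h) = Q.ι a :=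
    fun a b h => Q.precomp_ι (homOfLE h)
  have hι : ∀ a b (h : a ≤ b), (Q.ι a).precomp (c a).ι =
      ((Q.ι b).precomp (c b).ι).precomp (D.map (homOfLE (AttachIndex.stage_le lvl h))) := by
    intro a b h
    rw [← hQ a b h]
    refine (Points.precomp_comp _ _ _).symm.trans ?_
    rw [ι_attachHom]
    exact Points.precomp_comp _ _ _
  obtain ⟨f, hf⟩ := P.exists_hom Y
    (fun j => (Q.ι (AttachIndex.base lvl j)).precomp (c (AttachIndex.base lvl j)).ι)
    (fun i j h => (hι (AttachIndex.base lvl i) (AttachIndex.base lvl j)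
      ⟨leOfHom h, subset_rfl⟩).symm)
  have hf' : ∀ a : AttachIndex lvl, (P.ι a.stage).map f = (Q.ι a).precomp (c a).ι := by
    intro a
    refine ((hf _).trans (hι (AttachIndex.base lvl a.stage) a
      ⟨le_rfl, Finset.empty_subset _⟩)).trans (Eq.trans ?_ (Points.precomp_id _))
    congr 1
    exact D.map_id _
  -- Chains are lifted only on finite sets of indices, so such a set is carried as a second
  -- coordinate of the inverse system.
  have : IsDirectedOrder (AttachIndex lvl × Finset I) := by
    refine ⟨fun a b => ?_⟩
    obtain ⟨c, hac, hbc⟩ := exists_ge_ge a.1 b.1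
    exact ⟨(c, a.2 ∪ b.2), ⟨hac, Finset.subset_union_left⟩, ⟨hbc, Finset.subset_union_right⟩⟩
  obtain ⟨z, hz, hzc⟩ := exists_compatible_of_compact (J := AttachIndex lvl × Finset I)
    (Z := fun a => I → S.obj (op (c a.1).pt))
    (fun (a b : AttachIndex lvl × Finset I) (h : a ≤ b) y i => S.map (attachHom c hc a.1 b.1 h.1).op (y i))
    (fun a b h => continuous_pi fun i => (map_continuous S _).comp (continuous_apply i))
    (fun a b d h h' y => funext fun i => by
      rw [← map_comp_apply]
      exact congrArg (fun g => S.map (Quiver.Hom.op g) (y i))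
        ((attachDiagram c hc).map_comp (homOfLE h.1) (homOfLE h'.1)).symm)
    (fun a => {y | (∀ i ∈ a.2, ∀ j ∈ a.2, i ≤ j → y i ≤ y j) ∧
      (∀ i ∈ a.2, S.map (c a.1).ι.op (y i) = (x i).eval (P.ι a.1.stage)) ∧
      ∀ τ hτ, idx τ ∈ a.2 → S.map ((c a.1).κ τ hτ).op (y (idx τ)) ∈ K τ})
    (fun a => by
      simp only [Set.ofPred_and, Set.ofPred_forall]
      refine .inter ?_ (.inter ?_ ?_)
      · exact isClosed_iInter fun i => isClosed_iInter fun _ => isClosed_iInter fun j =>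
          isClosed_iInter fun _ => isClosed_iInter fun _ =>
            isClosed_le (continuous_apply i) (continuous_apply j)
      · exact isClosed_iInter fun i => isClosed_iInter fun _ =>
          isClosed_eq ((map_continuous S _).comp (continuous_apply i)) continuous_const
      · exact isClosed_iInter fun τ => isClosed_iInter fun _ => isClosed_iInter fun _ =>
          (hK τ).isClosed.preimage ((map_continuous S _).comp (continuous_apply (idx τ))))
    (fun a => by
      -- The indices of the attached tasks are added, as `exists_attachCocone` requires.
      obtain ⟨y, h1, h2, h3⟩ := hy a.1 (a.2 ∪ a.1.tasks.image idx)
        fun τ hτ => Finset.mem_union_right _ (Finset.mem_image_of_mem _ hτ)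
      exact ⟨y, fun i hi j hj => h1 (Finset.mem_union_left _ hi) (Finset.mem_union_left _ hj),
        fun i hi => h2 i (Finset.mem_union_left _ hi), fun τ hτ _ => h3 τ hτ⟩)
    (fun a b h y hy => by
      refine ⟨fun i hi j hj hij => map_mono S _ (hy.1 i (h.2 hi) j (h.2 hj) hij), fun i hi => ?_,
        fun τ hτ hi => ?_⟩
      · rw [← map_comp_apply, ι_attachHom, map_comp_apply, hy.2.1 i (h.2 hi), P.map_eval_ι]
      · rw [← map_comp_apply, κ_attachHom]
        exact hy.2.2 τ _ (h.2 hi))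
  -- Changing only the finite set is an identity transition, so `z (a, ∅)` meets the conditions for
  -- every finite set.
  have hzA : ∀ a A, z (a, ∅) = z (a, A) := by
    intro a A
    rw [← hzc (a, ∅) (a, A) ⟨le_rfl, Finset.empty_subset _⟩]
    funext i
    have h := (attachDiagram c hc).map_id a
    exact (congrArg (fun h => S.map (Quiver.Hom.op h) (z (a, A) i)) h).trans (map_id_apply S _)
  have hex : ∀ i, ∃ y : TypeSpace S Y, ∀ a, y.eval (Q.ι a) = z (a, ∅) i := fun i =>
    Q.exists_type (fun a => z (a, ∅) i) fun a b h =>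
      congrFun (hzc (a, ∅) (b, ∅) ⟨leOfHom h, subset_rfl⟩) i
  choose y hy' using hex
  refine ⟨Y, f, y, fun i j h => Q.le_of_eval_ι_le fun a => ?_, fun i => P.ext_ι fun j => ?_,
    fun τ => ?_⟩
  · rw [hy', hy', hzA a {i, j}]
    exact (hz (a, {i, j})).1 i (by simp) j (by simp) h
  · rw [TypeSpace.eval_precomp, hf]
    refine (TypeSpace.eval_precomp_point _ _ _).trans ((congrArg _ (hy' i _)).trans ?_)
    rw [hzA _ {i}]
    exact (hz (AttachIndex.base lvl j, {i})).2.1 i (by simp)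
  · have hτ : τ ∈ (AttachIndex.single lvl τ).tasks := Finset.mem_singleton_self τ
    refine ⟨(Q.ι (AttachIndex.single lvl τ)).precomp ((c _).κ τ hτ), ?_, ?_⟩
    · have h := hf' (AttachIndex.single lvl τ)
      rw [← hr τ, Points.map_precomp]
      refine Eq.trans ?_ (congrArg (Points.precomp (r τ)) h.symm)
      refine (Points.precomp_comp _ _ _).symm.trans ((congrArg (fun g => Points.precomp g _)
        ((c (AttachIndex.single lvl τ)).w τ hτ).symm).trans ?_)
      refine (Points.precomp_comp _ _ _).trans ?_
      refine congrArg (fun g => Points.precomp g _) ?_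
      exact (congrArg (r τ ≫ ·) (D.map_id _)).trans (Category.comp_id _)
    · have h := (hz (AttachIndex.single lvl τ, {idx τ})).2.2 τ hτ (by simp)
      rw [← hzA] at h
      exact Set.mem_of_eq_of_mem ((TypeSpace.eval_precomp_point _ _ _).trans
        (congrArg _ (hy' (idx τ) _))) h

/-! ### Chains of types and their saturation -/

/-- An ind-object together with a chain of types. -/
structure TypeChain (S : Cᵒᵖ ⥤ KOrd.{v}) where
  X : Ind C
  L : Set (TypeSpace S X)
  isChain : IsChain (· ≤ ·) L

/-- An extension of a chain of types along a morphism of ind-objects, without new lower bounds. -/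
structure TypeChain.Hom (A B : TypeChain S) where
  f : A.X ⟶ B.X
  s : A.L → B.L
  monotone : Monotone s
  precomp_s : ∀ x, (s x).1.precomp f = x.1
  coinitial : ∀ z : B.L, ∃ x : A.L, s x ≤ z

/-- The saturation conditions of Gödel–Dummett models for the points and the types of the smaller
chain hold in the larger one. -/
structure TypeChain.Hom.IsSaturating {A B : TypeChain S} (h : A.Hom B) : Prop where
  existential : ∀ (x : A.L) {n m : C} (σ : n ⟶ m) (p : Points A.X n) (t : S.obj (op m)),
    S.map σ.op t ≤ x.1.eval p →
      ∃ q : Points B.X m, q.precomp σ = p.map h.f ∧ t ≤ (h.s x).1.eval q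
  universal : ∀ (x : A.L) {n m : C} (σ : n ⟶ m) (p : Points A.X n) (t : S.obj (op m)),
    x.1.eval p ≤ S.map σ.op t →
      ∃ z : B.L, h.s x ≤ z ∧ ∃ q : Points B.X m, q.precomp σ = p.map h.f ∧ z.1.eval q = t

section Tasks

variable [EssentiallySmall.{v} C]

/-- An amalgamable condition on a chain of types over a small model of `C`. -/
structure Task (A : TypeChain S) : Type v where
  n : SmallModel.{v} C
  m : SmallModel.{v} C
  σ : (equivSmallModel C).inverse.obj n ⟶ (equivSmallModel C).inverse.obj m
  p : Points A.X ((equivSmallModel C).inverse.obj n)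
  i : Shrink.{v} A.L
  K : Set (S.obj (op ((equivSmallModel C).inverse.obj m)))
  isAmalgamable : IsAmalgamable σ (((equivShrink A.L).symm i).1.eval p) K

/-- Every chain of types extends to a larger ind-object so that all amalgamable conditions are
satisfied. -/
theorem TypeChain.exists_forall_isAmalgamable [HasPushouts C] (hS : IsPolyadic S)
    (hGD : IsGodelDummett S) (A : TypeChain S) :
    ∃ (Y : Ind C) (f : A.X ⟶ Y) (s : A.L → TypeSpace S Y), Monotone s ∧
      (∀ x, (s x).precomp f = x.1) ∧
      ∀ (x : A.L) {n m : C} (σ : n ⟶ m) (p : Points A.X n) (K : Set (S.obj (op m))),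
        IsAmalgamable σ (x.1.eval p) K →
          ∃ q : Points Y m, q.precomp σ = p.map f ∧ (s x).eval q ∈ K := by
  classical
  let := A.isChain.linearOrder
  obtain ⟨Y, f, s, hs, hsf, h⟩ := exists_extension hS hGD (X := A.X) (I := A.L)
    (x := fun x => x.1) (fun _ _ h => h) (fun τ : Task A => τ.σ) (fun τ => τ.p)
    (fun τ => (equivShrink A.L).symm τ.i) (fun τ => τ.isAmalgamable)
  refine ⟨Y, f, s, hs, hsf, fun x n m σ p K hK => ?_⟩
  obtain ⟨i, rfl⟩ := (equivShrink A.L).symm.surjective x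
  let φ := ((equivSmallModel C).unitIso.app n).symm
  let ψ := ((equivSmallModel C).unitIso.app m).symm
  obtain ⟨q, hq, hqK⟩ := h ⟨_, _, φ.hom ≫ σ ≫ ψ.inv, p.precomp φ.hom, i,
    S.map ψ.inv.op ⁻¹' K, by
      rw [TypeSpace.eval_precomp_point]
      exact hK.of_iso φ ψ⟩
  dsimp only at hq hqK
  refine ⟨q.precomp ψ.inv, ?_, by rwa [TypeSpace.eval_precomp_point]⟩
  have := congrArg (Points.precomp φ.inv) hq
  rw [← Points.precomp_comp, φ.inv_hom_id_assoc, Points.map_precomp, ← Points.precomp_comp,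
    φ.inv_hom_id, Points.precomp_id] at this
  rw [← Points.precomp_comp, this]

/-- The new chain consists of all types above some extended old type. This makes room for the raised
types demanded by universal saturation. -/
theorem TypeChain.exists_isSaturating [HasPushouts C] (hS : IsPolyadic S)
    (hGD : IsGodelDummett S) (A : TypeChain S) :
    ∃ (B : TypeChain S) (h : A.Hom B), h.IsSaturating := by
  obtain ⟨Y, f, s, hs, hsf, h⟩ := A.exists_forall_isAmalgamable hS hGD
  have hchain : IsChain (· ≤ ·) {z | ∃ x, s x ≤ z} := by
    rintro z ⟨x, hx⟩ z' ⟨x', hx'⟩ -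
    rcases A.isChain.total x.2 x'.2 with hxx | hxx
    · exact TypeSpace.isLocallyLinear hGD Y _ _ _ hx ((hs hxx).trans hx')
    · exact TypeSpace.isLocallyLinear hGD Y _ _ _ ((hs hxx).trans hx) hx'
  refine ⟨⟨Y, {z | ∃ x, s x ≤ z}, hchain⟩, ⟨f, fun x => ⟨s x, x, le_rfl⟩, hs, hsf,
    fun z => z.2⟩, ?_, ?_⟩
  · intro x n m σ p t ht
    exact h x σ p _ (isAmalgamable_Ici hS ht)
  · intro x n m σ p t ht
    obtain ⟨q, hq, hqt⟩ := h x σ p _ (isAmalgamable_Iic hS hGD ht)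
    obtain ⟨z, hz, hzt⟩ := TypeSpace.exists_ge_eval_eq hS (s x) q hqt
    exact ⟨⟨z, x, hz⟩, hz, q, hq, hzt⟩

end Tasks

/-! ### The limit of a sequence of saturating extensions -/

/-- The missing initial terms are the restrictions of the first given one. -/
theorem exists_compatible_types_of_eventually {X : ℕ → Ind C} (f : ∀ k, X k ⟶ X (k + 1)) (k : ℕ)
    (w : ∀ l, k ≤ l → TypeSpace S (X l))
    (hw : ∀ l h, (w (l + 1) (Nat.le_succ_of_le h)).precomp (f l) = w l h) :
    ∃ z : ∀ l, TypeSpace S (X l), (∀ l, (z (l + 1)).precomp (f l) = z l) ∧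
      ∀ l h, z l = w l h := by
  induction k with
  | zero => exact ⟨fun l => w l l.zero_le, fun l => hw l _, fun l _ => rfl⟩
  | succ k ih =>
    obtain ⟨w', hk, hw'⟩ : ∃ w' : ∀ l, k ≤ l → TypeSpace S (X l),
        w' k le_rfl = (w (k + 1) le_rfl).precomp (f k) ∧
          ∀ l (h : k + 1 ≤ l) h', w' l h' = w l h := by
      refine ⟨fun l hl => if h : k + 1 ≤ l then w l h else
        (show k = l by omega) ▸ (w (k + 1) le_rfl).precomp (f k), ?_, fun l h _ => dif_pos h⟩
      exact dif_neg (by omega)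
    obtain ⟨z, hz, hzw⟩ := ih w' fun l h => by
      rcases h.eq_or_lt with rfl | h'
      · rw [hk, hw' _ le_rfl]
      · rw [hw' _ h', hw' _ (Nat.le_succ_of_le h'), hw]
    exact ⟨z, hz, fun l h => (hzw l (Nat.le_of_succ_le h)).trans (hw' l h _)⟩

/-- Every chain of types has a saturated extension. -/
theorem TypeChain.exists_saturated [EssentiallySmall.{v} C] [HasPushouts C] (hS : IsPolyadic S)
    (hGD : IsGodelDummett S) (A₀ : TypeChain S) :
    ∃ (B : TypeChain S), Nonempty (A₀.Hom B) ∧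
      (∀ (z : B.L) {n m : C} (σ : n ⟶ m) (p : Points B.X n) (t : S.obj (op m)),
        S.map σ.op t ≤ z.1.eval p →
          ∃ q : Points B.X m, q.precomp σ = p ∧ t ≤ z.1.eval q) ∧
      ∀ (z : B.L) {n m : C} (σ : n ⟶ m) (p : Points B.X n) (t : S.obj (op m)),
        z.1.eval p ≤ S.map σ.op t →
          ∃ z' : B.L, z ≤ z' ∧ ∃ q : Points B.X m, q.precomp σ = p ∧ z'.1.eval q = t := by
  choose next hom hsat using fun A : TypeChain S => A.exists_isSaturating hS hGD
  let A : ℕ → TypeChain S := fun k => Nat.rec A₀ (fun _ => next) k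
  let h : ∀ k, (A k).Hom (A (k + 1)) := fun k => hom (A k)
  have hh : ∀ k, (h k).IsSaturating := fun k => hsat (A k)
  obtain ⟨Y, g, hg, hsurj, hdesc⟩ := exists_sequential_colimit (fun k => (A k).X)
    (fun k => (h k).f)
  have hsurj' : ∀ {n : C} (p : Points Y n) (k : ℕ),
      ∃ (l : ℕ) (r : Points (A l).X n), k ≤ l ∧ r.map (g l) = p := by
    intro n p k
    obtain ⟨l, r, hr⟩ := hsurj p
    suffices H : ∀ d, ∃ r : Points (A (l + d)).X n, r.map (g (l + d)) = p by
      obtain ⟨r', hr'⟩ := H k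
      exact ⟨l + k, r', Nat.le_add_left _ _, hr'⟩
    intro d
    induction d with
    | zero => exact ⟨r, hr⟩
    | succ d ih =>
      obtain ⟨r', hr'⟩ := ih
      exact ⟨r'.map (h (l + d)).f, by rw [← hr', ← hg (l + d), Points.map_comp]; rfl⟩
  -- Coherence from stage `k` on: the restrictions lie in the chains and follow the chosen
  -- extensions `(h l).s`. Saturation speaks of these extensions, and their monotonicity lets an
  -- inequality at one stage propagate to all later ones.
  let Coh : ℕ → TypeSpace S Y → Prop := fun k z => ∀ l, k ≤ l →
    ∃ hl : z.precomp (g l) ∈ (A l).L, ((h l).s ⟨_, hl⟩).1 = z.precomp (g (l + 1))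
  have hCoh_mono : ∀ {k k' z}, k ≤ k' → Coh k z → Coh k' z :=
    fun hk hz l hl => hz l (hk.trans hl)
  have hCoh_le : ∀ {k z z'}, Coh k z → Coh k z' → z.precomp (g k) ≤ z'.precomp (g k) →
      z ≤ z' := by
    intro k z z' hz hz' hle
    have H : ∀ l, k ≤ l → z.precomp (g l) ≤ z'.precomp (g l) := by
      intro l hl
      induction l, hl using Nat.le_induction with
      | base => exact hle
      | succ l hl ih =>
        obtain ⟨h1, h2⟩ := hz l hl
        obtain ⟨h3, h4⟩ := hz' l hl
        rw [← h2, ← h4]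
        exact (h l).monotone (show (⟨_, h1⟩ : (A l).L) ≤ ⟨_, h3⟩ from ih)
    intro n p
    obtain ⟨l, r, hl, rfl⟩ := hsurj' p k
    exact H l hl n r
  have hlift : ∀ k (x : (A k).L), ∃ z, Coh k z ∧ z.precomp (g k) = x.1 := by
    intro k x
    let w : ∀ l, k ≤ l → (A l).L := fun l hl =>
      Nat.leRec (motive := fun l _ => (A l).L) x (fun l _ => (h l).s) hl
    have hw0 : w k le_rfl = x := Nat.leRec_self _ _
    have hw1 : ∀ l (hl : k ≤ l), w (l + 1) (Nat.le_succ_of_le hl) = (h l).s (w l hl) :=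
      fun l hl => Nat.leRec_succ _ _ _
    clear_value w
    obtain ⟨z, hz, hzw⟩ := exists_compatible_types_of_eventually (fun k => (h k).f) k
      (fun l hl => (w l hl).1) fun l hl => by rw [hw1, (h l).precomp_s]
    obtain ⟨y, hy⟩ : ∃ y : TypeSpace S Y, ∀ l, y.precomp (g l) = z l :=
      hdesc (S ⋙ forget KOrd.{v}) z hz
    refine ⟨y, fun l hl => ?_, ?_⟩
    · have h1 : y.precomp (g l) = (w l hl).1 := (hy l).trans (hzw l hl)
      refine ⟨h1 ▸ (w l hl).2, ?_⟩
      rw [hy (l + 1), hzw (l + 1) (Nat.le_succ_of_le hl), hw1 l hl]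
      exact congrArg (fun u => ((h l).s u).1) (Subtype.ext h1)
    · rw [hy, hzw k le_rfl, hw0]
  choose lift hlift_coh hlift_eq using hlift
  have hchain : IsChain (· ≤ ·) {z | ∃ k, Coh k z} := by
    rintro z ⟨k, hk⟩ z' ⟨k', hk'⟩ -
    have h1 := hCoh_mono (le_max_left k k') hk
    have h2 := hCoh_mono (le_max_right k k') hk'
    exact ((A _).isChain.total (h1 _ le_rfl).1 (h2 _ le_rfl).1).imp (hCoh_le h1 h2)
      (hCoh_le h2 h1)
  -- Composes the coinitiality of the single steps, so that the limit has no new lower bounds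
  -- either.
  have hcoinit : ∀ k (u : (A k).L), ∃ x : (A 0).L, (lift 0 x).precomp (g k) ≤ u.1 := by
    intro k
    induction k with
    | zero => exact fun u => ⟨u, (hlift_eq 0 u).le⟩
    | succ k ih =>
      intro u
      obtain ⟨x, hx⟩ := (h k).coinitial u
      obtain ⟨x₀, hx₀⟩ := ih x
      obtain ⟨h1, h2⟩ := hlift_coh 0 x₀ k k.zero_le
      exact ⟨x₀, h2.ge.trans (((h k).monotone (show (⟨_, h1⟩ : (A k).L) ≤ x from hx₀)).trans hx)⟩
  refine ⟨⟨Y, {z | ∃ k, Coh k z}, hchain⟩, ⟨⟨g 0, fun x => ⟨lift 0 x, 0, hlift_coh 0 x⟩,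
    fun x x' hx => ?_, fun x => hlift_eq 0 x, ?_⟩⟩, ?_, ?_⟩
  · refine hCoh_le (hlift_coh 0 x) (hlift_coh 0 x') ?_
    rw [hlift_eq, hlift_eq]
    exact hx
  · rintro ⟨z, k, hk⟩
    obtain ⟨x, hx⟩ := hcoinit k ⟨_, (hk k le_rfl).1⟩
    exact ⟨x, hCoh_le (hCoh_mono k.zero_le (hlift_coh 0 x)) hk hx⟩
  · rintro ⟨z, k, hk⟩ n m σ p t ht
    obtain ⟨l, r, hl, rfl⟩ := hsurj' p k
    obtain ⟨h1, h2⟩ := hk l hl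
    obtain ⟨q, hq, hqt⟩ := (hh l).existential ⟨_, h1⟩ σ r t ht
    refine ⟨q.map (g (l + 1)), ?_, ?_⟩
    · rw [← Points.map_precomp, hq, ← Points.map_comp, hg]
    · rw [h2] at hqt
      exact hqt
  · rintro ⟨z, k, hk⟩ n m σ p t ht
    obtain ⟨l, r, hl, rfl⟩ := hsurj' p k
    obtain ⟨h1, h2⟩ := hk l hl
    obtain ⟨x, hx, q, hq, hqt⟩ := (hh l).universal ⟨_, h1⟩ σ r t ht
    refine ⟨⟨lift (l + 1) x, l + 1, hlift_coh (l + 1) x⟩, ?_, q.map (g (l + 1)), ?_, ?_⟩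
    · refine hCoh_le (hCoh_mono (Nat.le_succ_of_le hl) hk) (hlift_coh (l + 1) x) ?_
      rw [← h2, hlift_eq]
      exact hx
    · rw [← Points.map_precomp, hq, ← Points.map_comp, hg]
    · rw [← hqt, ← hlift_eq (l + 1) x]
      rfl

end Polyadic

/-! ### Indexing the saturated chain, and completeness -/

theorem mainTheorem12 {C : Type u} [Category.{v} C] [EssentiallySmall.{v} C] [HasPushouts C]
    (S : Cᵒᵖ ⥤ KOrd.{v}) (hS : Polyadic.IsPolyadic S) (hGD : Polyadic.IsGodelDummett S) :
    (∀ (X : Ind C) (I : Type v) [LinearOrder I] (x : I → Polyadic.TypeSpace S X), Monotone x →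
      ∃ (Y : Ind C) (f : X ⟶ Y) (I' : Type v) (_ : LinearOrder I') (e : I ↪o I')
        (y : I' → Polyadic.TypeSpace S Y),
        Polyadic.IsGodelDummettModel y ∧
        (∀ i : I, (y (e i)).precomp f = x i) ∧
        (∀ i : I, IsMin i → IsMin (e i))) ∧
    (∀ (n : C) (t : S.obj (op n)),
      ∃ (Y : Ind C) (I' : Type v) (_ : LinearOrder I') (y : I' → Polyadic.TypeSpace S Y)
        (i₀ : I') (p : Polyadic.Points Y n),
        Polyadic.IsGodelDummettModel y ∧ IsMin i₀ ∧ (y i₀).eval p = t) := by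
  have key : ∀ (X : Ind C) (I : Type v) [LinearOrder I] (x : I → Polyadic.TypeSpace S X),
      Monotone x →
      ∃ (Y : Ind C) (f : X ⟶ Y) (I' : Type v) (_ : LinearOrder I') (e : I ↪o I')
        (y : I' → Polyadic.TypeSpace S Y),
        Polyadic.IsGodelDummettModel y ∧
        (∀ i : I, (y (e i)).precomp f = x i) ∧
        (∀ i : I, IsMin i → IsMin (e i)) := by
    intro X I _ x hx
    classical
    obtain ⟨B, ⟨F⟩, hE, hU⟩ := Polyadic.TypeChain.exists_saturated hS hGD
      ⟨X, Set.range x, hx.isChain_range⟩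
    let : LinearOrder B.L := B.isChain.linearOrder
    let : LinearOrder (Shrink.{v} B.L) :=
      LinearOrder.lift' (equivShrink B.L).symm (equivShrink B.L).symm.injective
    let ε : Shrink.{v} B.L ≃o B.L := ⟨(equivShrink B.L).symm, Iff.rfl⟩
    let z : I → B.L := fun i => F.s ⟨x i, i, rfl⟩
    have hz : Monotone z := fun i j h => F.monotone (hx h)
    -- The family `x` may repeat values, so `z` need not be injective; the lexicographic factor `I`
    -- separates equal types without changing the model conditions.
    let e : I → Shrink.{v} B.L ×ₗ I := fun i => toLex (ε.symm (z i), i)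
    have he : StrictMono e := by
      intro i j h
      rw [Prod.Lex.toLex_lt_toLex]
      rcases (hz h.le).lt_or_eq with h' | h'
      · exact .inl (ε.symm.lt_iff_lt.2 h')
      · exact .inr ⟨congrArg ε.symm h', h⟩
    refine ⟨B.X, F.f, Shrink.{v} B.L ×ₗ I, inferInstance, OrderEmbedding.ofStrictMono e he,
      fun a => (ε (ofLex a).1).1, ⟨?_, ?_, ?_⟩, fun i => ?_, fun i hi a _ => ?_⟩
    · intro a b hab
      exact ε.monotone (Prod.Lex.monotone_fst_ofLex hab)
    · intro a n m σ p t ht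
      exact hE _ σ p t ht
    · intro a n m σ p t ht
      obtain ⟨z', hz', q, hq, hqt⟩ := hU _ σ p t ht
      refine ⟨toLex (ε.symm z', (ofLex a).2), ?_, q, hq, ?_⟩
      · rw [Prod.Lex.le_iff]
        have h' : (ofLex a).1 ≤ ε.symm z' := (ε.le_symm_apply).2 hz'
        rcases h'.lt_or_eq with h' | h'
        · exact .inl h'
        · exact .inr ⟨h', le_rfl⟩
      · simpa using hqt
    · change (ε (ε.symm (z i))).1.precomp F.f = x i
      rw [ε.apply_symm_apply]
      exact F.precomp_s _
    · change e i ≤ a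
      rw [Prod.Lex.le_iff]
      have h' : ε.symm (z i) ≤ (ofLex a).1 := by
        obtain ⟨⟨_, j, rfl⟩, hj⟩ := F.coinitial (ε (ofLex a).1)
        refine (ε.symm_apply_le).2 (le_trans (hz ?_) hj)
        exact (le_total i j).elim id fun h => hi h
      rcases h'.lt_or_eq with h' | h'
      · exact .inl h'
      · exact .inr ⟨h', (le_total i _).elim id fun h => hi h⟩
  refine ⟨key, fun n t => ?_⟩
  -- For completeness, the one-element chain on the representable `n` given by `t` is extended; the
  -- point is the image of `𝟙 n`.
  let X : Ind C := Ind.yoneda.obj n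
  let φ := Ind.yonedaCompInclusion.app n
  let x : Polyadic.TypeSpace S X :=
    φ.hom ≫ (yonedaEquiv (F := S ⋙ forget KOrd.{v})).symm t
  let p : Polyadic.Points X n := φ.inv.app (op n) (𝟙 n)
  obtain ⟨Y, f, I', _, e, y, hy, hyx, hmin⟩ := key X PUnit (fun _ => x) monotone_const
  refine ⟨Y, I', inferInstance, y, e PUnit.unit, p.map f, hy, hmin _ (fun _ _ => le_rfl), ?_⟩
  rw [← Polyadic.TypeSpace.eval_precomp, hyx]
  have h : φ.inv ≫ x = (yonedaEquiv (F := S ⋙ forget KOrd.{v})).symm t := φ.inv_hom_id_assoc _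
  exact (congrArg yonedaEquiv h).trans (Equiv.apply_symm_apply _ _)
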